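/- Let $\nu>0$, $\pi\in(0,1)$, and let $X\sim\mathrm{NB}(\nu,\pi)$, i.e. $\mathbb P(X=x)=\binom{\nu+x-1}{x}(1-\pi)^x\pi^\nu$ for $x\in\mathbb N_0$; write $\mu=\frac{\nu(1-\pi)}{\pi}$ and $\sigma^2=\frac{\nu(1-\pi)}{\pi^2}$ for its mean and variance. Let $f:\mathbb N_0\to\mathbb R$ be such that $\mathbb E[f(X+1)^2]$, $\mathbb E[X^2f(X)^2]$ and $\mathbb E[X^2f(X+1)^2]$ are finite, and put $\tilde\mu_f(k,l,m)=\mathbb E[X^k f(X)^l f(X+1)^m]$ for $k,l,m\in\mathbb N_0$. Let $X_1,X_2,\ldots$ be i.i.d. with distribution $\mathrm{NB}(\nu,\pi)$, let $$Z_i=\big(X_i,\ f(X_i+1),\ X_if(X_i),\ X_if(X_i+1)\big)^\top,\qquad \overline Z=\frac1n\sum_{i=1}^n Z_i .$$ Then $Z_i$ is square-integrable with mean $$\mu_Z=\mathbb E[Z_i]=\big(\mu,\ \tilde\mu_f(0,0,1),\ \tilde\mu_f(1,1,0),\ \tilde\mu_f(1,0,1)\big)^\top ,$$ and, as $n\to\infty$,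 $$\sqrt n\,\big(\overline Z-\mu_Z\big)\ \xrightarrow{\ d\ }\ \mathrm N(\mathbf 0,\Sigma),\qquad \Sigma=(\sigma_{ij})_{i,j=1,\ldots,4},$$ where $\mathrm N(\mathbf 0,\Sigma)$ is the four-dimensional normal distribution and $\Sigma$, which is symmetric and positive semidefinite, is the covariance matrix of $Z_i$, given by $$\begin{aligned} \sigma_{11}&=\sigma^2, & \sigma_{23}&=\tilde\mu_f(1,1,1)-\tilde\mu_f(0,0,1)\,\tilde\mu_f(1,1,0),\\ \sigma_{12}&=\tilde\mu_f(1,0,1)-\mu\,\tilde\mu_f(0,0,1), & \sigma_{24}&=\tilde\mu_f(1,0,2)-\tilde\mu_f(0,0,1)\,\tilde\mu_f(1,0,1),\\ \sigma_{13}&=\tilde\mu_f(2,1,0)-\mu\,\tilde\mu_f(1,1,0), & \sigma_{33}&=\tilde\mu_f(2,2,0)-\tilde\mu_f(1,1,0)^2,\\ \sigma_{14}&=\tilde\mu_f(2,0,1)-\mu\,\tilde\mu_f(1,0,1), & \sigma_{34}&=\tilde\mu_f(2,1,1)-\tilde\mu_f(1,1,0)\,\tilde\mu_f(1,0,1),\\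 \sigma_{22}&=\tilde\mu_f(0,0,2)-\tilde\mu_f(0,0,1)^2, & \sigma_{44}&=\tilde\mu_f(2,0,2)-\tilde\mu_f(1,0,1)^2 . \end{aligned}$$ -/

import Mathlib

open MeasureTheory ProbabilityTheory Filter
open scoped Topology

namespace SteinNB

/-- The probability mass function `x ↦ (ν + x - 1 choose x) (1 - p) ^ x p ^ ν` of the negative
binomial distribution `NB(ν, p)`, with the generalized binomial coefficient of the real number
`ν + x - 1`. -/
noncomputable def nbMass (ν p : ℝ) (x : ℕ) : ℝ :=
  Ring.choose (ν + x - 1) x * (1 - p) ^ x * p ^ ν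

/-- The negative binomial distribution `NB(ν, p)` (for `0 < ν` and `0 < p < 1`) as a measure
on `ℕ`. -/
noncomputable def nbMeasure (ν p : ℝ) : Measure ℕ :=
  Measure.sum (fun x : ℕ ↦ ENNReal.ofReal (nbMass ν p x) • Measure.dirac x)

lemma nbMass_nonneg {ν p : ℝ} (hν : 0 < ν) (hp0 : 0 < p) (hp1 : p < 1) (x : ℕ) :
    0 ≤ nbMass ν p x := by
  have h : 0 ≤ Ring.choose (ν + x - 1) x := by
    rw [← Ring.multichoose_eq]
    have h1 := Ring.factorial_nsmul_multichoose_eq_ascPochhammer ν x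
    rw [Polynomial.ascPochhammer_smeval_eq_eval, nsmul_eq_mul] at h1
    have h2 : 0 < (ascPochhammer ℝ x).eval ν := ascPochhammer_pos x ν hν
    have h3 : (0 : ℝ) < x.factorial := by exact_mod_cast x.factorial_pos
    rw [← h1] at h2
    exact (pos_of_mul_pos_right h2 h3.le).le
  have h4 : 0 ≤ 1 - p := by linarith
  unfold nbMass
  positivity

/-- The negative binomial probabilities sum to one. -/
lemma hasSum_nbMass {ν p : ℝ} (hp0 : 0 < p) (hp1 : p < 1) : HasSum (nbMass ν p) 1 := by
  have h := (Real.one_div_one_sub_rpow_hasFPowerSeriesOnBall_zero ν).hasSum (y := 1 - p)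
    (by
      rw [← ENNReal.ofReal_one, Metric.eball_ofReal, mem_ball_zero_iff, Real.norm_eq_abs, abs_lt]
      constructor <;> linarith)
  have h2 := h.mul_right (p ^ ν)
  have h3 : p ^ ν ≠ 0 := (Real.rpow_pos_of_pos hp0 ν).ne'
  have h4 : nbMass ν p = fun x : ℕ ↦ (1 - p) ^ x * Ring.choose (ν + x - 1) x * p ^ ν := by
    ext x
    simp only [nbMass]
    ring
  rw [h4]
  simpa [FormalMultilinearSeries.ofScalars_apply_eq, h3, smul_eq_mul] using h2

lemma isProbabilityMeasure_nbMeasure {ν p : ℝ} (hν : 0 < ν) (hp0 : 0 < p) (hp1 : p < 1) :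
    IsProbabilityMeasure (nbMeasure ν p) :=
  (hasSum_nbMass hp0 hp1).isProbabilityMeasure_sum_dirac (nbMass_nonneg hν hp0 hp1)

/-- The mean `μ` of `NB(ν, p)`. -/
noncomputable def nbMean (ν p : ℝ) : ℝ := ν * (1 - p) / p

/-- The variance `σ ^ 2` of `NB(ν, p)`. -/
noncomputable def nbVar (ν p : ℝ) : ℝ := ν * (1 - p) / p ^ 2

/-- The joint moment `E[X ^ k * f(X) ^ l * f(X + 1) ^ m]` for `X ∼ NB(ν, p)`. -/
noncomputable def nbMoment (ν p : ℝ) (f : ℕ → ℝ) (k l m : ℕ) : ℝ :=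
  ∫ x, (x : ℝ) ^ k * f x ^ l * f (x + 1) ^ m ∂(nbMeasure ν p)

/-- The vector `(x, f(x + 1), x f(x), x f(x + 1))`. -/
noncomputable def zVec (f : ℕ → ℝ) (x : ℕ) : EuclideanSpace ℝ (Fin 4) :=
  !₂[(x : ℝ), f (x + 1), x * f x, x * f (x + 1)]

/-- The mean vector. -/
noncomputable def zMean (ν p : ℝ) (f : ℕ → ℝ) : EuclideanSpace ℝ (Fin 4) :=
  !₂[nbMean ν p, nbMoment ν p f 0 0 1, nbMoment ν p f 1 1 0, nbMoment ν p f 1 0 1]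

/-- The asymptotic covariance matrix, a symmetric matrix written out entry by entry. -/
noncomputable def zCov (ν p : ℝ) (f : ℕ → ℝ) : Matrix (Fin 4) (Fin 4) ℝ :=
  let μ := nbMean ν p
  let M := nbMoment ν p f
  let s12 := M 1 0 1 - μ * M 0 0 1
  let s13 := M 2 1 0 - μ * M 1 1 0
  let s14 := M 2 0 1 - μ * M 1 0 1
  let s23 := M 1 1 1 - M 0 0 1 * M 1 1 0
  let s24 := M 1 0 2 - M 0 0 1 * M 1 0 1
  let s34 := M 2 1 1 - M 1 1 0 * M 1 0 1
  !![nbVar ν p, s12, s13, s14;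
     s12, M 0 0 2 - M 0 0 1 ^ 2, s23, s24;
     s13, s23, M 2 2 0 - M 1 1 0 ^ 2, s34;
     s14, s24, s34, M 2 0 2 - M 1 0 1 ^ 2]

end SteinNB

/-! By Cramér–Wold, in the form of Lévy continuity, the vector CLT reduces to the real CLT for each
projection `⟪Z i, t⟫`, whose variance is the quadratic form of the covariance matrix at `t`
(`variance_inner`). The three moment hypotheses and `E[X^2] < ∞` put each coordinate of `zVec` in
L², so the mixed moments are finite as well. Only the mean and variance need closed forms; they
follow from the size-bias identity `succ_mul_nbMass_succ`. -/

namespace MultivariateCLT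

open Matrix WithLp
open scoped RealInnerProductSpace

variable {ι : Type*} [Fintype ι] {Ω : Type*} [MeasurableSpace Ω] {P : Measure Ω}

/-- The variance of a linear functional of a square-integrable vector. -/
lemma variance_inner [IsFiniteMeasure P] {Z : Ω → EuclideanSpace ℝ ι} (hZ : MemLp Z 2 P)
    {S : Matrix ι ι ℝ} (hS : ∀ a b, cov[fun ω ↦ Z ω a, fun ω ↦ Z ω b; P] = S a b)
    (t : EuclideanSpace ℝ ι) :
    Var[fun ω ↦ ⟪Z ω, t⟫; P] = t ⬝ᵥ S *ᵥ t := by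
  have hc (a : ι) : MemLp (fun ω ↦ t a * Z ω a) 2 P := (hZ.eval_piLp a).const_mul _
  have h : (fun ω ↦ ⟪Z ω, t⟫) = fun ω ↦ ∑ a, t a * Z ω a := by
    ext ω; simp [PiLp.inner_apply]
  rw [h, ← covariance_self (memLp_finsetSum _ fun a _ ↦ hc a).aemeasurable,
    covariance_fun_sum_fun_sum hc hc]
  simp only [covariance_const_mul_left, covariance_const_mul_right, hS, dotProduct, mulVec,
    Finset.mul_sum]
  refine Finset.sum_congr rfl fun a _ ↦ Finset.sum_congr rfl fun b _ ↦ ?_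
  ring

lemma posSemidef_of_cov [IsFiniteMeasure P] {Z : Ω → EuclideanSpace ℝ ι} (hZ : MemLp Z 2 P)
    {S : Matrix ι ι ℝ} (hS : ∀ a b, cov[fun ω ↦ Z ω a, fun ω ↦ Z ω b; P] = S a b) :
    S.PosSemidef := by
  refine .of_dotProduct_mulVec_nonneg (Matrix.IsHermitian.ext fun a b ↦ ?_) fun x ↦ ?_
  · rw [star_trivial, ← hS, ← hS, covariance_comm]
  · exact (variance_inner hZ hS (toLp 2 x)) ▸ variance_nonneg _ _

/-- **Multivariate central limit theorem** for i.i.d. square-integrable vectors. -/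
theorem tendstoInDistribution [DecidableEq ι] [IsProbabilityMeasure P]
    {Z : ℕ → Ω → EuclideanSpace ℝ ι} (hZ : MemLp (Z 0) 2 P) (hindep : iIndepFun Z P)
    (hident : ∀ i, IdentDistrib (Z i) (Z 0) P P)
    {S : Matrix ι ι ℝ} (hS : ∀ a b, cov[fun ω ↦ Z 0 ω a, fun ω ↦ Z 0 ω b; P] = S a b) :
    TendstoInDistribution
      (fun (n : ℕ) (ω : Ω) ↦ Real.sqrt n •
        ((n : ℝ)⁻¹ • (∑ i ∈ Finset.range n, Z i ω) - P[Z 0]))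
      atTop (id : EuclideanSpace ℝ ι → EuclideanSpace ℝ ι) (fun _ ↦ P)
      (multivariateGaussian 0 S) where
  forall_aemeasurable n := by
    have h := Finset.aemeasurable_fun_sum (Finset.range n) fun i _ ↦ (hident i).aemeasurable_fst
    fun_prop
  tendsto := by
    have hm : ∀ n : ℕ, AEMeasurable (fun ω : Ω ↦ Real.sqrt n •
        ((n : ℝ)⁻¹ • (∑ i ∈ Finset.range n, Z i ω) - P[Z 0])) P := fun n ↦ by
      have h := Finset.aemeasurable_fun_sum (Finset.range n) fun i _ ↦ (hident i).aemeasurable_fst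
      fun_prop
    refine ProbabilityMeasure.tendsto_iff_tendsto_charFun.2 fun t ↦ ?_
    have hZt : MemLp (fun ω ↦ ⟪Z 0 ω, t⟫) 2 P := hZ.inner_const t
    have hmean : ∫ ω, ⟪Z 0 ω, t⟫ ∂P = ⟪P[Z 0], t⟫ := by
      simp_rw [real_inner_comm t]
      exact integral_inner (hZ.integrable one_le_two) t
    have hclt := tendstoInDistribution_inv_sqrt_mul_sum_sub
      (X := fun i ω ↦ ⟪Z i ω, t⟫) (P := P) (Y := id)
      (P' := gaussianReal 0 Var[fun ω ↦ ⟪Z 0 ω, t⟫; P].toNNReal) HasLaw.id hZt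
      (hindep.comp (fun _ x ↦ ⟪x, t⟫) fun _ ↦ by fun_prop)
      (fun i ↦ (hident i).comp (u := fun x ↦ ⟪x, t⟫) (by fun_prop))
    -- The characteristic function of the projection on `t`, taken at 1, is that of the vector at
    -- `t`.
    have hlim := ProbabilityMeasure.tendsto_iff_tendsto_charFun.1 hclt.tendsto 1
    simp only [ProbabilityMeasure.coe_mk, Measure.map_id] at hlim ⊢
    have htarget : charFun (gaussianReal 0 Var[fun ω ↦ ⟪Z 0 ω, t⟫; P].toNNReal) 1
        = charFun (multivariateGaussian 0 S) t := by
      rw [charFun_gaussianReal, charFun_multivariateGaussian (posSemidef_of_cov hZ hS),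
        ← variance_inner hZ hS t, Real.coe_toNNReal _ (variance_nonneg _ _)]
      simp
    rw [htarget] at hlim
    refine hlim.congr fun n ↦ ?_
    rw [charFun_apply, charFun_apply, integral_map (hclt.forall_aemeasurable n) (by fun_prop),
      integral_map (hm n) (by fun_prop)]
    refine integral_congr_ae (ae_of_all _ fun ω ↦ ?_)
    have key : (Real.sqrt n)⁻¹ * (∑ k ∈ Finset.range n, ⟪Z k ω, t⟫ - n * ∫ ω, ⟪Z 0 ω, t⟫ ∂P)
        = ⟪Real.sqrt n • ((n : ℝ)⁻¹ • (∑ i ∈ Finset.range n, Z i ω) - P[Z 0]), t⟫ := by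
      rw [real_inner_smul_left, inner_sub_left, real_inner_smul_left, sum_inner, hmean]
      -- At `n = 0` both sides vanish, since `√0 = 0` and `0⁻¹ = 0`.
      rcases n.eq_zero_or_pos with rfl | hn
      · simp
      have hn' : (0 : ℝ) < n := by exact_mod_cast hn
      have hs : Real.sqrt n ≠ 0 := (Real.sqrt_pos.2 hn').ne'
      have hsq : (n : ℝ) = Real.sqrt n * Real.sqrt n := (Real.mul_self_sqrt hn'.le).symm
      generalize Real.sqrt n = s at *
      rw [hsq]
      field_simp
    simp [key]

end MultivariateCLT

namespace SteinNB

/-- Size-biasing maps `NB(ν, p)` to a shift of `NB(ν + 1, p)`. -/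
lemma succ_mul_nbMass_succ {ν p : ℝ} (hp0 : 0 < p) (x : ℕ) :
    ((x + 1 : ℕ) : ℝ) * nbMass ν p (x + 1) = nbMean ν p * nbMass (ν + 1) p x := by
  -- Clearing the factorial leaves a rising factorial, and that of `ν` of length `x + 1` is `ν`
  -- times that of `ν + 1` of length `x`.
  have e (μ : ℝ) (k : ℕ) :
      (k.factorial : ℝ) * Ring.choose (μ + k - 1) k = (ascPochhammer ℝ k).eval μ := by
    rw [← Ring.multichoose_eq, ← nsmul_eq_mul, Ring.factorial_nsmul_multichoose_eq_ascPochhammer,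
      Polynomial.ascPochhammer_smeval_eq_eval]
  have h1 := e ν (x + 1)
  have h2 := e (ν + 1) x
  rw [ascPochhammer_succ_left, Polynomial.eval_mul, Polynomial.eval_X, Polynomial.eval_comp,
    Polynomial.eval_add, Polynomial.eval_X, Polynomial.eval_one, ← h2, Nat.factorial_succ,
    Nat.cast_mul] at h1
  have hf : (x.factorial : ℝ) ≠ 0 := by positivity
  have h3 : ((x + 1 : ℕ) : ℝ) * Ring.choose (ν + (x + 1 : ℕ) - 1) (x + 1)
      = ν * Ring.choose (ν + 1 + x - 1) x := by
    apply mul_left_cancel₀ hf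
    linear_combination h1
  simp only [nbMass, nbMean]
  rw [Real.rpow_add hp0, Real.rpow_one, pow_succ]
  field_simp
  linear_combination (1 - p) ^ x * (1 - p) * h3

/-- The term at `x = 0` vanishes, so the sum can be shifted by one and size-biased termwise. Taking
`g = 1` and then `g x = x` yields the first two moments. -/
lemma hasSum_mul_nbMass {ν p s : ℝ} (hp0 : 0 < p) {g : ℕ → ℝ}
    (h : HasSum (fun x ↦ g (x + 1) * nbMass (ν + 1) p x) s) :
    HasSum (fun x : ℕ ↦ x * g x * nbMass ν p x) (nbMean ν p * s) := by
  rw [← hasSum_nat_add_iff' 1]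
  simp only [Finset.range_one, Finset.sum_singleton, Nat.cast_zero, zero_mul, sub_zero]
  refine (h.mul_left (nbMean ν p)).congr_fun fun x ↦ ?_
  linear_combination g (x + 1) * succ_mul_nbMass_succ (ν := ν) hp0 x

lemma hasSum_id_mul_nbMass {ν p : ℝ} (hp0 : 0 < p) (hp1 : p < 1) :
    HasSum (fun x : ℕ ↦ x * nbMass ν p x) (nbMean ν p) := by
  simpa using hasSum_mul_nbMass (ν := ν) (s := 1) hp0 (g := fun _ ↦ 1)
    (by simpa using hasSum_nbMass hp0 hp1)

lemma hasSum_sq_mul_nbMass {ν p : ℝ} (hp0 : 0 < p) (hp1 : p < 1) :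
    HasSum (fun x : ℕ ↦ (x : ℝ) ^ 2 * nbMass ν p x) (nbVar ν p + nbMean ν p ^ 2) := by
  have h := hasSum_mul_nbMass (ν := ν) (s := nbMean (ν + 1) p + 1) hp0 (g := fun x ↦ x)
    (by simpa [add_mul] using (hasSum_id_mul_nbMass hp0 hp1).add (hasSum_nbMass hp0 hp1))
  convert h using 1
  · ext x; ring
  · simp only [nbVar, nbMean]
    field_simp
    ring

lemma integrable_nbMeasure_iff {ν p : ℝ} (hν : 0 < ν) (hp0 : 0 < p) (hp1 : p < 1) {g : ℕ → ℝ} :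
    Integrable g (nbMeasure ν p) ↔ Summable fun x ↦ nbMass ν p x * ‖g x‖ := by
  rw [nbMeasure, integrable_sum_dirac_iff (by simp)]
  simp only [ENNReal.toReal_ofReal (nbMass_nonneg hν hp0 hp1 _)]

lemma integral_nbMeasure {ν p : ℝ} (hν : 0 < ν) (hp0 : 0 < p) (hp1 : p < 1) (g : ℕ → ℝ) :
    ∫ x, g x ∂(nbMeasure ν p) = ∑' x, nbMass ν p x * g x := by
  rw [nbMeasure, integral_sum_dirac (by simp)]
  simp only [ENNReal.toReal_ofReal (nbMass_nonneg hν hp0 hp1 _), smul_eq_mul]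

lemma integral_id_nbMeasure {ν p : ℝ} (hν : 0 < ν) (hp0 : 0 < p) (hp1 : p < 1) :
    ∫ x : ℕ, (x : ℝ) ∂(nbMeasure ν p) = nbMean ν p := by
  rw [integral_nbMeasure hν hp0 hp1, ← (hasSum_id_mul_nbMass hp0 hp1).tsum_eq]
  simp only [mul_comm]

lemma integral_sq_nbMeasure {ν p : ℝ} (hν : 0 < ν) (hp0 : 0 < p) (hp1 : p < 1) :
    ∫ x : ℕ, (x : ℝ) ^ 2 ∂(nbMeasure ν p) = nbVar ν p + nbMean ν p ^ 2 := by
  rw [integral_nbMeasure hν hp0 hp1, ← (hasSum_sq_mul_nbMass hp0 hp1).tsum_eq]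
  simp only [mul_comm]

lemma integrable_sq_nbMeasure {ν p : ℝ} (hν : 0 < ν) (hp0 : 0 < p) (hp1 : p < 1) :
    Integrable (fun x : ℕ ↦ (x : ℝ) ^ 2) (nbMeasure ν p) := by
  rw [integrable_nbMeasure_iff hν hp0 hp1]
  simpa [mul_comm] using (hasSum_sq_mul_nbMass (ν := ν) hp0 hp1).summable

section Moments

variable {ν p : ℝ} {f : ℕ → ℝ}

lemma memLp_zVec (hν : 0 < ν) (hp0 : 0 < p) (hp1 : p < 1)
    (h002 : Integrable (fun x : ℕ ↦ f (x + 1) ^ 2) (nbMeasure ν p))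
    (h220 : Integrable (fun x : ℕ ↦ (x : ℝ) ^ 2 * f x ^ 2) (nbMeasure ν p))
    (h202 : Integrable (fun x : ℕ ↦ (x : ℝ) ^ 2 * f (x + 1) ^ 2) (nbMeasure ν p)) :
    MemLp (zVec f) 2 (nbMeasure ν p) := by
  refine MemLp.of_eval_piLp fun a ↦ ?_
  rw [memLp_two_iff_integrable_sq .of_discrete]
  fin_cases a
  · simpa [zVec] using integrable_sq_nbMeasure hν hp0 hp1
  · simpa [zVec] using h002
  · simpa [zVec, mul_pow] using h220
  · simpa [zVec, mul_pow] using h202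

lemma integral_zVec_apply (hν : 0 < ν) (hp0 : 0 < p) (hp1 : p < 1) (a : Fin 4) :
    ∫ x, zVec f x a ∂(nbMeasure ν p) = zMean ν p f a := by
  fin_cases a
  · simpa [zVec, zMean] using integral_id_nbMeasure hν hp0 hp1
  all_goals simp [zVec, zMean, nbMoment]

lemma integral_zVec (hν : 0 < ν) (hp0 : 0 < p) (hp1 : p < 1)
    (hZ : MemLp (zVec f) 2 (nbMeasure ν p)) :
    ∫ x, zVec f x ∂(nbMeasure ν p) = zMean ν p f := by
  have := isProbabilityMeasure_nbMeasure hν hp0 hp1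
  ext a
  rw [eval_integral_piLp fun b ↦ (hZ.eval_piLp b).integrable one_le_two,
    integral_zVec_apply hν hp0 hp1]

lemma cov_zVec (hν : 0 < ν) (hp0 : 0 < p) (hp1 : p < 1)
    (hZ : MemLp (zVec f) 2 (nbMeasure ν p)) (a b : Fin 4) :
    cov[fun x ↦ zVec f x a, fun x ↦ zVec f x b; nbMeasure ν p] = zCov ν p f a b := by
  have := isProbabilityMeasure_nbMeasure hν hp0 hp1
  rw [covariance_eq_sub (hZ.eval_piLp a) (hZ.eval_piLp b), integral_zVec_apply hν hp0 hp1,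
    integral_zVec_apply hν hp0 hp1]
  have hsq := integral_sq_nbMeasure hν hp0 hp1
  fin_cases a <;> fin_cases b
  -- Only this entry is stated in closed form instead of as a difference of moments, so it needs the
  -- computed value of `E[X^2]`.
  · simp only [zVec, zMean, zCov, Pi.mul_apply, ← pow_two]
    simp [hsq]
  all_goals
    refine congrArg₂ (· - ·) (integral_congr_ae (ae_of_all _ fun x ↦ ?_)) ?_
    · simp only [zVec, Pi.mul_apply, Fin.reduceFinMk, Fin.zero_eta, Fin.mk_one, Fin.isValue,
        PiLp.toLp_apply, Matrix.cons_val]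
      ring
    · simp only [zMean, Fin.reduceFinMk, Fin.zero_eta, Fin.mk_one, Fin.isValue,
        PiLp.toLp_apply, Matrix.cons_val]
      try ring

end Moments

end SteinNB

theorem mainTheorem6 {Ω : Type*} [MeasurableSpace Ω] (P : Measure Ω) [IsProbabilityMeasure P]
    (ν p : ℝ) (hν : 0 < ν) (hp0 : 0 < p) (hp1 : p < 1)
    (f : ℕ → ℝ)
    (h002 : Integrable (fun x : ℕ ↦ f (x + 1) ^ 2) (SteinNB.nbMeasure ν p))
    (h220 : Integrable (fun x : ℕ ↦ (x : ℝ) ^ 2 * f x ^ 2) (SteinNB.nbMeasure ν p))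
    (h202 : Integrable (fun x : ℕ ↦ (x : ℝ) ^ 2 * f (x + 1) ^ 2) (SteinNB.nbMeasure ν p))
    (X : ℕ → Ω → ℕ) (hindep : iIndepFun X P)
    (hlaw : ∀ i, HasLaw (X i) (SteinNB.nbMeasure ν p) P) :
    (∀ i, MemLp (fun ω ↦ SteinNB.zVec f (X i ω)) 2 P) ∧
    (∀ i, ∫ ω, SteinNB.zVec f (X i ω) ∂P = SteinNB.zMean ν p f) ∧
    (∀ i a b, cov[fun ω ↦ SteinNB.zVec f (X i ω) a, fun ω ↦ SteinNB.zVec f (X i ω) b; P] =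
      SteinNB.zCov ν p f a b) ∧
    (SteinNB.zCov ν p f).PosSemidef ∧
    TendstoInDistribution
      (fun (n : ℕ) (ω : Ω) ↦ Real.sqrt n •
        ((n : ℝ)⁻¹ • (∑ i ∈ Finset.range n, SteinNB.zVec f (X i ω)) - SteinNB.zMean ν p f))
      atTop (id : EuclideanSpace ℝ (Fin 4) → EuclideanSpace ℝ (Fin 4)) (fun _ ↦ P)
      (multivariateGaussian 0 (SteinNB.zCov ν p f)) := by
  have hZ := SteinNB.memLp_zVec hν hp0 hp1 h002 h220 h202
  have hmean := SteinNB.integral_zVec hν hp0 hp1 hZ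
  have hlawZ (i : ℕ) : MemLp (fun ω ↦ SteinNB.zVec f (X i ω)) 2 P := by
    rw [← (hlaw i).map_eq] at hZ
    exact hZ.comp_of_map (hlaw i).aemeasurable
  have hmeanZ (i : ℕ) : ∫ ω, SteinNB.zVec f (X i ω) ∂P = SteinNB.zMean ν p f :=
    ((hlaw i).integral_comp .of_discrete).trans hmean
  have hcovZ (i : ℕ) (a b : Fin 4) :
      cov[fun ω ↦ SteinNB.zVec f (X i ω) a, fun ω ↦ SteinNB.zVec f (X i ω) b; P] =
        SteinNB.zCov ν p f a b :=
    ((hlaw i).covariance_fun_comp (f := fun x ↦ SteinNB.zVec f x a)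
      (g := fun x ↦ SteinNB.zVec f x b) .of_discrete .of_discrete).trans
      (SteinNB.cov_zVec hν hp0 hp1 hZ a b)
  refine ⟨hlawZ, hmeanZ, hcovZ, MultivariateCLT.posSemidef_of_cov (hlawZ 0) (hcovZ 0), ?_⟩
  rw [← hmeanZ 0]
  exact MultivariateCLT.tendstoInDistribution (hlawZ 0)
    (hindep.comp (fun _ ↦ SteinNB.zVec f) fun _ ↦ .of_discrete)
    (fun i ↦ ((hlaw i).identDistrib (hlaw 0)).comp .of_discrete) (hcovZ 0)
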